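/- A chord diagram of size $n$ is a pairing of $2n$ linearly ordered points $1<2<\dots<2n$ (its $n$ pairs are called chords); two chords $\{a,a'\}$, $\{b,b'\}$ with $a<a'$, $b<b'$, $a<b$ cross if $a<b<a'<b'$. Let $T_{n,m}$ be the number of chord diagrams of size $n$ in which exactly $m$ pairs of chords cross, let $I_{n,m}$ be the number of permutations of $[n]=\{1,\dots,n\}$ with exactly $m$ inversions, and let $C_n=\frac1{n+1}\binom{2n}{n}$ be the $n$-th Catalan number. For $n=0$ the symbol $\binom{n+m-1}{n-1}$ is read as $1$ if $m=0$ and as $0$ if $m>0$ (so that it is the coefficient of $x^m$ in $(1-x)^{-n}$ for all $n,m\ge 0$). (i) For all integers $n,m\ge 0$, \[ T_{n,m}\le C_n I_{n,m}\le C_n\binom{n+m-1}{n-1}. \] (ii) If $n\to\infty$ and $m=o(n^{3/2})$, where $n$ and $m$ run through sequences of nonnegative integers, then \[ \exp\Bigl[-2\,\frac mn\,\log n\Bigr]\,C_n\binom{n+m-1}{n-1}=O(T_{n,m}), \] that is, there is a constant $c>0$ with $T_{n,m}\ge c\,\exp[-2(m/n)\log n]\,C_n\binom{n+m-1}{n-1}$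 for all sufficiently late terms of the sequence. -/

import Mathlib

open Filter Asymptotics

namespace ChordDiagrams

/-- A chord diagram of size `n`, i.e. a pairing of the `2 * n` points `0 < 1 < ⋯ < 2n - 1`, encoded
by the fixed-point-free involution sending each point to the other endpoint of its chord. -/
def IsChordDiagram (n : ℕ) (σ : Equiv.Perm (Fin (2 * n))) : Prop :=
  (∀ x, σ (σ x) = x) ∧ ∀ x, σ x ≠ x

instance (n : ℕ) : DecidablePred (IsChordDiagram n) := fun σ =>
  inferInstanceAs (Decidable ((∀ x, σ (σ x) = x) ∧ ∀ x, σ x ≠ x))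

/-- The number of crossings, i.e. of unordered pairs of chords that cross: a pair of chords
with initial points `a < b` crosses exactly when `a < b < σ a < σ b`, and the pair of chords
is determined by `(a, b)`. -/
def crossings {n : ℕ} (σ : Equiv.Perm (Fin (2 * n))) : ℕ :=
  (Finset.univ.filter fun p : Fin (2 * n) × Fin (2 * n) =>
    p.1 < p.2 ∧ p.2 < σ p.1 ∧ σ p.1 < σ p.2).card

/-- `T n m`: the number of chord diagrams of size `n` with exactly `m` crossings. -/
def T (n m : ℕ) : ℕ :=
  (Finset.univ.filter fun σ : Equiv.Perm (Fin (2 * n)) =>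
    IsChordDiagram n σ ∧ crossings σ = m).card

/-- The number of inversions of a permutation of `n` letters. -/
def inversions {n : ℕ} (p : Equiv.Perm (Fin n)) : ℕ :=
  (Finset.univ.filter fun ij : Fin n × Fin n => ij.1 < ij.2 ∧ p ij.2 < p ij.1).card

/-- `I n m`: the number of permutations of `n` letters with exactly `m` inversions. -/
def I (n m : ℕ) : ℕ :=
  (Finset.univ.filter fun p : Equiv.Perm (Fin n) => inversions p = m).card

/-- The binomial coefficient `binom(n + m - 1, n - 1)`, the coefficient of `x ^ m` in
`(1 - x) ^ (-n)`. For `n = 0` the lower index is `-1`, and the usual convention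
`binom(-1, -1) = 1`, `binom(m - 1, -1) = 0` for `m > 0`, is spelled out
(truncated subtraction would give `1` for every `m`). -/
def B (n m : ℕ) : ℕ :=
  if n = 0 then (if m = 0 then 1 else 0) else (n + m - 1).choose (n - 1)

end ChordDiagrams

/-! Scan the points of a chord diagram from left to right. A point either opens a chord or closes
one of the `j` open ones, and closing creates as many crossings as there are chords opened later and
still open. So `T n m` is the coefficient of `X ^ m` in a sum over Dyck paths where a down step from
height `j` weighs `qnat j` (`sum_partialDiagrams`).

Upper bound: the height never exceeds the number of down steps left, so every path weighs at most
`qfact n`, the inversion generating function, which is at most `geom ^ n`.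

Lower bound: keep only paths with `H` initial up steps and `H` final down steps. The final descent
contributes `qfact H`; the middle part has weights `qnat (H + j) = (1 - X ^ (H + j)) * geom`. The
inequality `∏ (1 - x_i) ≥ 1 - ∑ x_i` reduces the middle part to counting down steps by height, which
reflection bounds by `3 * j * catalan n`. Up to degree `m`, multiplying a power of `geom` by `X`
costs at least a factor `ρ`, so `X` may be replaced by `ρ` in the error terms. With `ρ = x / (1 +
x)`, `x` slightly above `m / n` and `H` about `2 * x * log x`, half of the middle part survives. The
total loss is `exp (-(H * log 4 + 2 * x))` up to a constant, and `log x ≤ (log n) / 2` makes this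
sufficient. -/

namespace ChordDiagrams

open PowerSeries Finset

/-! ### Power series and weighted lattice paths -/

/-- The geometric series `1 / (1 - X)`. -/
noncomputable def geom : ℝ⟦X⟧ := PowerSeries.mk 1

/-- The `q`-integer `1 + X + ⋯ + X ^ (h - 1)`. -/
noncomputable def qnat (h : ℕ) : ℝ⟦X⟧ := ∑ i ∈ range h, (X : ℝ⟦X⟧) ^ i

/-- The `q`-factorial. -/
noncomputable def qfact (n : ℕ) : ℝ⟦X⟧ := ∏ i ∈ range n, qnat (i + 1)

/-- The generating function of the nonnegative lattice paths with `l` steps `±1` from height `h`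
to height `0`, where a step down from height `j` has weight `qnat (H + j)`. -/
noncomputable def pathWeight (H : ℕ) : ℕ → ℕ → ℝ⟦X⟧
  | 0, 0 => 1
  | 0, _ + 1 => 0
  | l + 1, 0 => pathWeight H l 1
  | l + 1, h + 1 => pathWeight H l (h + 2) + qnat (H + h + 1) * pathWeight H l h

/-- The number of nonnegative lattice paths with `l` steps `±1` from height `h` to height `0`. -/
def paths : ℕ → ℕ → ℕ
  | 0, 0 => 1
  | 0, _ + 1 => 0
  | l + 1, 0 => paths l 1
  | l + 1, h + 1 => paths l (h + 2) + paths l h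

/-- Ranked from the top, the points of `O` have exponents `0, 1, …, O.card - 1`. This sums over the
choice of the open arc to close. -/
lemma sum_pow_card_filter_gt {α : Type*} [LinearOrder α] (O : Finset α) :
    ∑ a ∈ O, (X : ℝ⟦X⟧) ^ (O.filter (a < ·)).card = qnat O.card := by
  induction O using Finset.induction_on_min with
  | empty => simp [qnat]
  | insert a s ha ih =>
    have has : a ∉ s := fun h => lt_irrefl _ (ha a h)
    rw [sum_insert has, card_insert_of_notMem has, qnat, sum_range_succ, ← qnat, ← ih, add_comm]
    congr 1
    · refine sum_congr rfl fun b hb => ?_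
      rw [filter_insert, if_neg (ha b hb).not_gt]
    · rw [filter_insert, if_neg (lt_irrefl _), filter_true_of_mem ha]

/-! ### Crossings of chord diagrams as weighted Dyck paths -/

section Diagrams

variable {α : Type*} [LinearOrder α] [Fintype α]

/-- The number of crossings of the arcs of an involution. -/
def arcCrossings (σ : Equiv.Perm α) : ℕ :=
  (univ.filter fun p : α × α => p.1 < p.2 ∧ p.2 < σ p.1 ∧ σ p.1 < σ p.2).card

/-- Involutions with support `S` which send no point of `O` to a point of `O`. -/
def partialDiagrams (S O : Finset α) : Finset (Equiv.Perm α) :=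
  univ.filter fun σ => (∀ x, σ (σ x) = x) ∧ (∀ x, σ x ≠ x ↔ x ∈ S) ∧ ∀ a ∈ O, σ a ∉ O

lemma mem_partialDiagrams {S O : Finset α} {σ : Equiv.Perm α} :
    σ ∈ partialDiagrams S O ↔
      (∀ x, σ (σ x) = x) ∧ (∀ x, σ x ≠ x ↔ x ∈ S) ∧ ∀ a ∈ O, σ a ∉ O := by
  simp [partialDiagrams]

/-- `O` holds the left ends of arcs still open, and `S \ O` the points not yet scanned. A point not
matched into `O` opens a new arc. -/
lemma partialDiagrams_filter_open {S O : Finset α} {x : α} (hx : x ∈ S) :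
    (partialDiagrams S O).filter (fun σ => σ x ∉ O) = partialDiagrams S (insert x O) := by
  ext σ
  simp only [mem_filter, mem_partialDiagrams, mem_insert]
  constructor
  · rintro ⟨⟨h1, h2, h3⟩, h4⟩
    refine ⟨h1, h2, ?_⟩
    rintro a (rfl | ha) (h | h)
    · exact (h2 a).2 hx h
    · exact h4 h
    · apply h4; rw [← h, h1]; exact ha
    · exact h3 a ha h
  · rintro ⟨h1, h2, h3⟩
    exact ⟨⟨h1, h2, fun a ha h => h3 a (Or.inr ha) (Or.inr h)⟩,
      fun h => h3 x (Or.inl rfl) (Or.inr h)⟩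

/-- Removing an arc `(a, x)` which closes at the first point outside the set `O` of open points
destroys the crossings of this arc with the arcs opened after `a`. -/
lemma arcCrossings_swap_mul {S O : Finset α} {σ : Equiv.Perm α} {a x : α}
    (hσ : σ ∈ partialDiagrams S O) (hOS : O ⊆ S) (hx : x ∈ S)
    (hOx : ∀ b ∈ O, b < x) (hSx : ∀ b ∈ S, b ∉ O → x ≤ b) (ha : a ∈ O) (hax : σ x = a) :
    arcCrossings σ = arcCrossings (Equiv.swap a x * σ) + (O.filter (a < ·)).card := by
  obtain ⟨h1, h2, h3⟩ := mem_partialDiagrams.1 hσ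
  have hxa : σ a = x := by rw [← hax, h1]
  have hlt := hOx a ha
  have hval : ∀ y, y ≠ a → y ≠ x → (Equiv.swap a x * σ) y = σ y := by
    intro y hya hyx
    rw [Equiv.Perm.mul_apply, Equiv.swap_apply_of_ne_of_ne]
    · intro h; apply hyx; rw [← hxa, ← h, h1]
    · intro h; apply hya; rw [← hax, ← h, h1]
  have hva : (Equiv.swap a x * σ) a = a := by simp [hxa]
  have hvx : (Equiv.swap a x * σ) x = x := by simp [hax]
  have hlow : ∀ b, b < x → σ b ≠ b → b ∈ O := by
    intro b hb hbb
    by_contra hO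
    exact absurd (hSx b ((h2 b).1 hbb) hO) hb.not_ge
  have hout : ∀ b ∈ O, x ≤ σ b := by
    intro b hb
    refine hSx _ ((h2 _).1 ?_) (h3 b hb)
    rw [h1]
    exact ((h2 b).2 (hOS hb)).symm
  have himg : ((O.filter (a < ·)).image fun b => (a, b)).card = (O.filter (a < ·)).card :=
    card_image_of_injective _ fun b c h => (Prod.mk.inj h).2
  rw [← himg, arcCrossings, arcCrossings, ← card_union_of_disjoint]
  · congr 1
    ext ⟨b, c⟩
    simp only [mem_filter, mem_univ, true_and, mem_union, mem_image, Prod.mk.injEq]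
    -- Pairs with first arc `a` cross exactly when `c` is open and after `a`, since `σ c` then lies
    -- beyond `x`. Pairs in which `a` or `x` plays any other role cross neither before nor after the
    -- removal.
    by_cases hba : b = a
    · subst hba
      simp only [hva, true_and, hxa]
      constructor
      · rintro ⟨k1, k2, k3⟩
        refine Or.inr ⟨c, ⟨hlow c k2 (k2.trans k3).ne', k1⟩, rfl⟩
      · rintro (⟨k1, k2, k3⟩ | ⟨_, ⟨k1, k2⟩, rfl⟩)
        · exact absurd (k1.trans k2) (lt_irrefl _)
        · refine ⟨k2, hOx _ k1, lt_of_le_of_ne (hout _ k1) ?_⟩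
          intro h
          apply k2.ne
          rw [← hax, h, h1]
    · have hne : ¬ ∃ y, (y ∈ O ∧ a < y) ∧ a = b ∧ y = c := by
        rintro ⟨y, -, h, -⟩
        exact hba h.symm
      rw [or_iff_left hne]
      by_cases hbx : b = x
      · subst hbx
        simp only [hvx, hax]
        constructor <;> rintro ⟨k1, k2, k3⟩
        · exact absurd (k1.trans (k2.trans hlt)) (lt_irrefl _)
        · exact absurd (k1.trans k2) (lt_irrefl _)
      rw [hval b hba hbx]
      by_cases hca : c = a
      · subst hca
        simp only [hva, hxa]
        constructor <;> rintro ⟨k1, k2, k3⟩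
        · exact absurd k3 (hout b (hlow b (k1.trans hlt) (k1.trans k2).ne')).not_gt
        · exact absurd (k2.trans k3) (lt_irrefl _)
      by_cases hcx : c = x
      · subst hcx
        simp only [hvx, hax]
        constructor <;> rintro ⟨k1, k2, k3⟩
        · exact absurd (k2.trans (k3.trans hlt)) (lt_irrefl _)
        · exact absurd (k2.trans k3) (lt_irrefl _)
      rw [hval c hca hcx]
  · rw [disjoint_left]
    rintro ⟨b, c⟩ hb hc
    simp only [mem_filter, mem_univ, true_and, mem_image, Prod.mk.injEq] at hb hc
    obtain ⟨y, -, rfl, rfl⟩ := hc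
    rw [hva] at hb
    exact lt_irrefl _ (hb.1.trans hb.2.1)

lemma swap_mul_mem_partialDiagrams {S O : Finset α} {σ : Equiv.Perm α} {a x : α}
    (hσ : σ ∈ partialDiagrams S O) (hxO : x ∉ O) (hax : σ x = a) :
    Equiv.swap a x * σ ∈ partialDiagrams ((S.erase a).erase x) (O.erase a) := by
  obtain ⟨h1, h2, h3⟩ := mem_partialDiagrams.1 hσ
  have hxa : σ a = x := by rw [← hax, h1]
  have hval : ∀ y, y ≠ a → y ≠ x → (Equiv.swap a x * σ) y = σ y := by
    intro y hya hyx
    rw [Equiv.Perm.mul_apply, Equiv.swap_apply_of_ne_of_ne]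
    · intro h; apply hyx; rw [← hxa, ← h, h1]
    · intro h; apply hya; rw [← hax, ← h, h1]
  have hva : (Equiv.swap a x * σ) a = a := by simp [hxa]
  have hvx : (Equiv.swap a x * σ) x = x := by simp [hax]
  rw [mem_partialDiagrams]
  refine ⟨fun y => ?_, fun y => ?_, fun y hy => ?_⟩
  · by_cases hya : y = a
    · rw [hya, hva, hva]
    by_cases hyx : y = x
    · rw [hyx, hvx, hvx]
    rw [hval y hya hyx, hval, h1]
    · intro h; apply hyx; rw [← hxa, ← h, h1]
    · intro h; apply hya; rw [← hax, ← h, h1]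
  · by_cases hya : y = a
    · simp only [hya, hva, mem_erase]; tauto
    by_cases hyx : y = x
    · simp only [hyx, hvx, mem_erase]; tauto
    rw [hval y hya hyx, h2]
    simp [hya, hyx]
  · rw [mem_erase] at hy
    by_cases hyx : y = x
    · exact absurd (hyx ▸ hy.2) hxO
    rw [hval y hy.1 hyx, mem_erase]
    exact fun h => h3 y hy.2 h.2

lemma swap_mul_mem_partialDiagrams_of_erase {S O : Finset α} {τ : Equiv.Perm α} {a x : α}
    (hτ : τ ∈ partialDiagrams ((S.erase a).erase x) (O.erase a)) (haS : a ∈ S) (hxS : x ∈ S)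
    (hxO : x ∉ O) (haO : a ∈ O) :
    Equiv.swap a x * τ ∈ partialDiagrams S O ∧ (Equiv.swap a x * τ) x = a := by
  obtain ⟨h1, h2, h3⟩ := mem_partialDiagrams.1 hτ
  have hax : a ≠ x := fun h => hxO (h ▸ haO)
  have hta : τ a = a := by
    by_contra h
    simpa using (h2 a).1 h
  have htx : τ x = x := by
    by_contra h
    simpa using (h2 x).1 h
  have hval : ∀ y, y ≠ a → y ≠ x → (Equiv.swap a x * τ) y = τ y := by
    intro y hya hyx
    rw [Equiv.Perm.mul_apply, Equiv.swap_apply_of_ne_of_ne]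
    · intro h; apply hya; rw [← hta, ← h, h1]
    · intro h; apply hyx; rw [← htx, ← h, h1]
  have hva : (Equiv.swap a x * τ) a = x := by simp [hta]
  have hvx : (Equiv.swap a x * τ) x = a := by simp [htx]
  refine ⟨mem_partialDiagrams.2 ⟨fun y => ?_, fun y => ?_, fun y hy => ?_⟩, hvx⟩
  · by_cases hya : y = a
    · rw [hya, hva, hvx]
    by_cases hyx : y = x
    · rw [hyx, hvx, hva]
    rw [hval y hya hyx, hval, h1]
    · intro h; apply hya; rw [← hta, ← h, h1]
    · intro h; apply hyx; rw [← htx, ← h, h1]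
  · by_cases hya : y = a
    · simpa [hya, hva, haS] using hax.symm
    by_cases hyx : y = x
    · simpa [hyx, hvx, hxS] using hax
    rw [hval y hya hyx, h2]
    simp [hya, hyx]
  · by_cases hya : y = a
    · rw [hya, hva]; exact hxO
    have hyx : y ≠ x := fun h => hxO (h ▸ hy)
    rw [hval y hya hyx]
    intro h
    refine h3 y (mem_erase.2 ⟨hya, hy⟩) (mem_erase.2 ⟨?_, h⟩)
    intro h'
    apply hya
    rw [← hta, ← h', h1]

/-- Multiplying by the transposition of `a` and `x` deletes their arc, and multiplying again
restores it. -/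
lemma sum_partialDiagrams_close {S O : Finset α} {a x : α} (hOS : O ⊆ S) (hx : x ∈ S)
    (hOx : ∀ b ∈ O, b < x) (hSx : ∀ b ∈ S, b ∉ O → x ≤ b) (ha : a ∈ O) :
    ∑ σ ∈ (partialDiagrams S O).filter (fun σ => σ x = a), (X : ℝ⟦X⟧) ^ arcCrossings σ =
      X ^ (O.filter (a < ·)).card *
        ∑ τ ∈ partialDiagrams ((S.erase a).erase x) (O.erase a), X ^ arcCrossings τ := by
  have hxO : x ∉ O := fun h => lt_irrefl _ (hOx x h)
  rw [mul_sum]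
  refine sum_nbij' (fun σ => Equiv.swap a x * σ) (fun τ => Equiv.swap a x * τ) ?_ ?_ ?_ ?_ ?_
  · intro σ hσ
    rw [mem_filter] at hσ
    exact swap_mul_mem_partialDiagrams hσ.1 hxO hσ.2
  · intro τ hτ
    rw [mem_filter]
    exact swap_mul_mem_partialDiagrams_of_erase hτ (hOS ha) hx hxO ha
  · intro σ _
    simp
  · intro τ _
    simp
  · intro σ hσ
    rw [mem_filter] at hσ
    rw [arcCrossings_swap_mul hσ.1 hOS hx hOx hSx ha hσ.2, pow_add, mul_comm]

/-- The generating function of partial diagrams by crossings is a sum over weighted paths. -/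
theorem sum_partialDiagrams (l : ℕ) (S O : Finset α) (hOS : O ⊆ S)
    (hlow : ∀ a ∈ O, ∀ b ∈ S, b ∉ O → a < b) (hl : (S \ O).card = l) :
    ∑ σ ∈ partialDiagrams S O, (X : ℝ⟦X⟧) ^ arcCrossings σ = pathWeight 0 l O.card := by
  induction l generalizing S O with
  | zero =>
    have hSO : S = O := subset_antisymm (sdiff_eq_empty_iff_subset.1 (card_eq_zero.1 hl)) hOS
    subst hSO
    rcases S.eq_empty_or_nonempty with rfl | ⟨a, ha⟩
    · have : partialDiagrams (∅ : Finset α) ∅ = {1} := by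
        ext σ
        rw [mem_partialDiagrams, mem_singleton]
        constructor
        · rintro ⟨-, h, -⟩
          ext x
          simpa using h x
        · rintro rfl
          simp
      rw [this, sum_singleton]
      have : arcCrossings (1 : Equiv.Perm α) = 0 := by
        rw [arcCrossings, card_eq_zero, filter_eq_empty_iff]
        rintro ⟨b, c⟩ - ⟨h1, h2, -⟩
        exact lt_irrefl _ (h1.trans h2)
      rw [this, card_empty, pow_zero, pathWeight]
    · have : partialDiagrams S S = ∅ := by
        rw [eq_empty_iff_forall_notMem]
        intro σ hσ
        obtain ⟨h1, h2, h3⟩ := mem_partialDiagrams.1 hσ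
        refine h3 a ha ((h2 _).1 ?_)
        rw [h1]
        exact ((h2 a).2 ha).symm
      rw [this, sum_empty]
      obtain ⟨k, hk⟩ := Nat.exists_eq_succ_of_ne_zero (card_pos.2 ⟨a, ha⟩).ne'
      rw [hk, pathWeight]
  | succ l ih =>
    have hne : (S \ O).Nonempty := card_pos.1 (by omega)
    set x := (S \ O).min' hne
    have hxm : x ∈ S \ O := min'_mem _ _
    obtain ⟨hxS, hxO⟩ := mem_sdiff.1 hxm
    have hSx : ∀ b ∈ S, b ∉ O → x ≤ b := fun b hb hbO => min'_le _ _ (mem_sdiff.2 ⟨hb, hbO⟩)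
    have hOx : ∀ b ∈ O, b < x := fun b hb => hlow b hb x hxS hxO
    -- The first unscanned point `x` either opens an arc (up step) or closes an open one (down
    -- step).
    rw [← sum_filter_not_add_sum_filter _ (fun σ => σ x ∈ O), partialDiagrams_filter_open hxS]
    have hopen : ∑ σ ∈ partialDiagrams S (insert x O), (X : ℝ⟦X⟧) ^ arcCrossings σ =
        pathWeight 0 l (O.card + 1) := by
      rw [ih S (insert x O) (insert_subset hxS hOS), card_insert_of_notMem hxO]
      · intro a ha b hb hbO
        rw [mem_insert, not_or] at hbO
        rcases mem_insert.1 ha with rfl | ha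
        · exact lt_of_le_of_ne (hSx b hb hbO.2) (Ne.symm hbO.1)
        · exact hlow a ha b hb hbO.2
      · rw [sdiff_insert, card_erase_of_mem hxm, hl]; rfl
    have hclose : ∑ σ ∈ (partialDiagrams S O).filter (fun σ => σ x ∈ O), (X : ℝ⟦X⟧) ^ arcCrossings σ
        = qnat O.card * pathWeight 0 l (O.card - 1) := by
      rw [← sum_pow_card_filter_gt, sum_mul,
        ← sum_fiberwise_of_maps_to (s := (partialDiagrams S O).filter (fun σ => σ x ∈ O)) (t := O)
          (g := fun σ => σ x) (fun σ hσ => (mem_filter.1 hσ).2)]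
      refine sum_congr rfl fun a ha => ?_
      have : ((partialDiagrams S O).filter (fun σ => σ x ∈ O)).filter (fun σ => σ x = a) =
          (partialDiagrams S O).filter (fun σ => σ x = a) := by
        ext σ
        simp only [mem_filter]
        constructor
        · rintro ⟨⟨h1, -⟩, h2⟩
          exact ⟨h1, h2⟩
        · rintro ⟨h1, h2⟩
          exact ⟨⟨h1, h2 ▸ ha⟩, h2⟩
      rw [this, sum_partialDiagrams_close hOS hxS hOx hSx ha, ih, card_erase_of_mem ha]
      · intro b hb
        rw [mem_erase] at hb
        rw [mem_erase, mem_erase]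
        exact ⟨(hOx b hb.2).ne, hb.1, hOS hb.2⟩
      · intro b hb c hc hcO
        simp only [mem_erase, not_and] at hb hc hcO
        exact hlow b hb.2 c hc.2.2 (hcO hc.2.1)
      · have : ((S.erase a).erase x) \ (O.erase a) = (S \ O).erase x := by
          ext y
          simp only [Finset.mem_sdiff, mem_erase]
          constructor
          · rintro ⟨⟨h1, h2, h3⟩, h4⟩
            exact ⟨h1, h3, fun h => h4 ⟨h2, h⟩⟩
          · rintro ⟨h1, h2, h3⟩
            exact ⟨⟨h1, fun h => h3 (h ▸ ha), h2⟩, fun h => h3 h.2⟩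
        rw [this, card_erase_of_mem hxm, hl]; rfl
    rw [hopen, hclose]
    -- With no open arc, `qnat 0 = 0` removes the term with the truncated height `0 - 1`.
    cases h : O.card with
    | zero => simp [pathWeight, qnat]
    | succ k => simp [pathWeight]

end Diagrams

lemma coeff_sum_X_pow {ι : Type*} (s : Finset ι) (f : ι → ℕ) (m : ℕ) :
    coeff m (∑ i ∈ s, (X : ℝ⟦X⟧) ^ f i) = ((s.filter fun i => f i = m).card : ℝ) := by
  rw [map_sum, card_filter, Nat.cast_sum]
  refine sum_congr rfl fun i _ => ?_
  rw [coeff_X_pow]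
  simp [eq_comm]

/-- Chord diagrams by crossings as weighted Dyck paths. -/
theorem T_eq_coeff (n m : ℕ) : (T n m : ℝ) = coeff m (pathWeight 0 (2 * n) 0) := by
  have h := sum_partialDiagrams (α := Fin (2 * n)) (2 * n) univ ∅ (by simp) (by simp) (by simp)
  rw [card_empty] at h
  rw [← h, coeff_sum_X_pow, T]
  congr 2
  ext σ
  rw [mem_filter, mem_filter, mem_partialDiagrams]
  simp [IsChordDiagram, crossings, arcCrossings]

/-! ### Inversions and the `q`-factorial -/

/-- The permutation with first value `k` and the remaining values in the relative order of `e`. -/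
def consPerm {n : ℕ} (k : Fin (n + 1)) (e : Equiv.Perm (Fin n)) : Equiv.Perm (Fin (n + 1)) :=
  (finSuccEquiv n).trans ((Equiv.optionCongr e).trans (finSuccEquiv' k).symm)

lemma consPerm_zero {n : ℕ} (k : Fin (n + 1)) (e : Equiv.Perm (Fin n)) : consPerm k e 0 = k := by
  simp [consPerm]

lemma consPerm_succ {n : ℕ} (k : Fin (n + 1)) (e : Equiv.Perm (Fin n)) (i : Fin n) :
    consPerm k e i.succ = k.succAbove (e i) := by
  simp [consPerm]

lemma consPerm_bijective (n : ℕ) :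
    Function.Bijective fun p : Fin (n + 1) × Equiv.Perm (Fin n) => consPerm p.1 p.2 := by
  rw [Fintype.bijective_iff_injective_and_card]
  constructor
  · rintro ⟨k, e⟩ ⟨k', e'⟩ h
    dsimp only at h
    have hk : k = k' := by rw [← consPerm_zero k e, h, consPerm_zero]
    subst hk
    congr 1
    ext i : 1
    apply Fin.succAbove_right_injective (p := k)
    rw [← consPerm_succ, ← consPerm_succ, h]
  · simp [Fintype.card_perm, Nat.factorial_succ]

/-- The first value `k` exceeds exactly `k` later values, and `succAbove` preserves the order of the
rest. -/
lemma inversions_consPerm {n : ℕ} (k : Fin (n + 1)) (e : Equiv.Perm (Fin n)) :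
    inversions (consPerm k e) = k + inversions e := by
  have h1 : (univ.filter fun j : Fin n => k.succAbove (e j) < k).card = k := by
    have : (univ.filter fun j : Fin n => k.succAbove (e j) < k) =
        (univ.filter fun j : Fin n => k.succAbove j < k).map e.symm.toEmbedding := by
      ext j
      simp
    rw [this, card_map]
    have : ((univ.filter fun j : Fin n => k.succAbove j < k).map k.succAboveEmb) =
        Iio k := by
      ext j
      simp only [Finset.mem_map, mem_filter, mem_univ, true_and, mem_Iio]
      constructor
      · rintro ⟨i, hi, rfl⟩
        exact hi
      · intro hj
        obtain ⟨i, rfl⟩ := Fin.exists_succAbove_eq hj.ne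
        exact ⟨i, hj, rfl⟩
    rw [← card_map k.succAboveEmb, this, Fin.card_Iio]
  rw [inversions, inversions, card_filter, ← univ_product_univ, sum_product, Fin.sum_univ_succ]
  congr 1
  · rw [Fin.sum_univ_succ]
    simp only [consPerm_zero, consPerm_succ, lt_irrefl, false_and, if_false, zero_add,
      Fin.succ_pos, true_and]
    rw [← card_filter, h1]
  · rw [card_filter, ← univ_product_univ, sum_product]
    refine sum_congr rfl fun i _ => ?_
    rw [Fin.sum_univ_succ]
    simp [consPerm_succ]

lemma sum_pow_inversions (n : ℕ) :
    ∑ p : Equiv.Perm (Fin n), (X : ℝ⟦X⟧) ^ inversions p = qfact n := by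
  induction n with
  | zero =>
    simp [qfact, inversions]
  | succ n ih =>
    rw [qfact, prod_range_succ, ← qfact, ← ih, ← (consPerm_bijective n).sum_comp, ← univ_product_univ,
      sum_product, qnat, ← Fin.sum_univ_eq_sum_range (fun i => (X : ℝ⟦X⟧) ^ i), mul_comm, sum_mul_sum]
    refine sum_congr rfl fun k _ => sum_congr rfl fun e _ => ?_
    rw [inversions_consPerm, pow_add]

theorem I_eq_coeff (n m : ℕ) : (I n m : ℝ) = coeff m (qfact n) := by
  rw [← sum_pow_inversions, coeff_sum_X_pow, I]

/-! ### Ballot and Catalan numbers -/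

lemma paths_eq_zero {l h : ℕ} (hl : l < h) : paths l h = 0 := by
  induction l generalizing h with
  | zero =>
    obtain ⟨k, rfl⟩ := Nat.exists_eq_succ_of_ne_zero hl.ne'
    rw [paths]
  | succ l ih =>
    obtain ⟨k, rfl⟩ := Nat.exists_eq_succ_of_ne_zero (Nat.ne_zero_of_lt hl)
    rw [paths, ih (by omega), ih (by omega)]

lemma paths_self (k : ℕ) : paths k k = 1 := by
  induction k with
  | zero => rw [paths]
  | succ k ih => rw [paths, ih, paths_eq_zero (by omega)]

/-- The ballot numbers. -/
lemma paths_mul (a k : ℕ) :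
    paths (2 * a + k) k * (2 * a + k + 1) = (k + 1) * (2 * a + k + 1).choose a := by
  suffices h : ∀ l a k, l = 2 * a + k →
      paths l k * (l + 1) = (k + 1) * (l + 1).choose a from h _ a k rfl
  intro l
  induction l with
  | zero =>
    rintro a k h
    obtain rfl : a = 0 := by omega
    obtain rfl : k = 0 := by omega
    simp [paths]
  | succ l ih =>
    rintro a k h
    rcases a with _ | a
    · obtain rfl : k = l + 1 := by omega
      simp [paths_self]
    have h1 := ih a (k + 1) (by omega)
    have hp := Nat.choose_succ_succ (l + 1) a
    have hu := Nat.choose_succ_right_eq (l + 1) a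
    rw [show l + 1 - a = a + k + 2 by omega] at hu
    obtain rfl : l = 2 * a + k + 1 := by omega
    rw [Nat.succ_eq_add_one, Nat.succ_eq_add_one] at hp
    rw [hp]
    generalize (2 * a + k + 1 + 1).choose a = u at *
    generalize hv : (2 * a + k + 1 + 1).choose (a + 1) = v at *
    rcases k with _ | k
    · rw [paths]
      zify at *
      have : (2 * a + 0 + 1 + 1 : ℤ) ≠ 0 := by positivity
      apply mul_right_cancel₀ this
      push_cast at *
      linear_combination (2 * (a : ℤ) + 3) * h1 - 2 * hu
    · have h2 := ih (a + 1) k (by omega)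
      rw [paths]
      rw [hv] at h2
      zify at *
      have : (2 * a + (k + 1) + 1 + 1 : ℤ) ≠ 0 := by positivity
      apply mul_right_cancel₀ this
      linear_combination (2 * (a : ℤ) + k + 4) * h1 + (2 * (a : ℤ) + k + 4) * h2 - 2 * hu

lemma catalan_mul_two_mul_add_one (n : ℕ) : catalan n * (2 * n + 1) = (2 * n + 1).choose n := by
  have h2 := succ_mul_catalan_eq_centralBinom n
  rw [Nat.centralBinom] at h2
  have h4 := Nat.add_one_mul_choose_eq (2 * n) n
  rw [← Nat.choose_symm_half] at *
  apply Nat.eq_of_mul_eq_mul_left (Nat.succ_pos n)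
  rw [Nat.succ_eq_add_one]
  linear_combination (2 * n + 1) * h2 + h4

lemma paths_two_mul_zero (n : ℕ) : paths (2 * n) 0 = catalan n := by
  apply Nat.eq_of_mul_eq_mul_right (Nat.succ_pos (2 * n))
  have h := paths_mul n 0
  rw [zero_add, one_mul, add_zero] at h
  rw [Nat.succ_eq_add_one, h, catalan_mul_two_mul_add_one]

/-- The ballot formula puts both sides over `2 * n + 1`; the middle binomial coefficient is the
largest. -/
lemma paths_two_mul_le (n j : ℕ) : paths (2 * n) (2 * j) ≤ (2 * j + 1) * catalan n := by
  rcases lt_or_ge n j with hj | hj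
  · rw [paths_eq_zero (by omega)]
    exact Nat.zero_le _
  · obtain ⟨a, rfl⟩ := Nat.exists_eq_add_of_le' hj
    have h := paths_mul a (2 * j)
    have h2 := catalan_mul_two_mul_add_one (a + j)
    have h3 := Nat.choose_le_middle a (2 * (a + j) + 1)
    rw [show (2 * (a + j) + 1) / 2 = a + j by omega, ← h2] at h3
    rw [← mul_add] at h
    refine Nat.le_of_mul_le_mul_right ?_ (Nat.succ_pos (2 * (a + j)))
    rw [Nat.succ_eq_add_one, h, mul_assoc]
    exact Nat.mul_le_mul_left _ h3

lemma catalan_succ_le (n : ℕ) : catalan (n + 1) ≤ 4 * catalan n := by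
  have h1 := succ_mul_catalan_eq_centralBinom n
  have h2 := succ_mul_catalan_eq_centralBinom (n + 1)
  have h3 := Nat.succ_mul_centralBinom_succ n
  have : (n + 1) * (n + 2) * catalan (n + 1) = (n + 1) * (2 * (2 * n + 1)) * catalan n := by
    linear_combination (n + 1) * h2 + h3 - (2 * (2 * n + 1)) * h1
  have h4 : (n + 2) * catalan (n + 1) = (2 * (2 * n + 1)) * catalan n := by
    apply Nat.eq_of_mul_eq_mul_left (Nat.succ_pos n)
    rw [Nat.succ_eq_add_one, ← mul_assoc, this, mul_assoc]
  apply Nat.le_of_mul_le_mul_left (c := n + 2) _ (by omega)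
  rw [h4]
  nlinarith

lemma catalan_add_le (n k : ℕ) : catalan (n + k) ≤ 4 ^ k * catalan n := by
  induction k with
  | zero => simp
  | succ k ih =>
    calc catalan (n + k + 1) ≤ 4 * catalan (n + k) := catalan_succ_le _
      _ ≤ 4 * (4 ^ k * catalan n) := by gcongr
      _ = _ := by ring

/-! ### Coefficientwise order -/

/-- Coefficientwise comparison of power series up to degree `m`. -/
def CoeffLE (m : ℕ) (F G : ℝ⟦X⟧) : Prop := ∀ s ≤ m, coeff s F ≤ coeff s G

namespace CoeffLE

variable {m : ℕ} {F G F' G' K : ℝ⟦X⟧}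

lemma self : CoeffLE m F F := fun _ _ => le_rfl

lemma trans (h : CoeffLE m F G) (h' : CoeffLE m G K) : CoeffLE m F K :=
  fun s hs => (h s hs).trans (h' s hs)

lemma add (h : CoeffLE m F G) (h' : CoeffLE m F' G') : CoeffLE m (F + F') (G + G') := by
  intro s hs
  rw [map_add, map_add]
  exact add_le_add (h s hs) (h' s hs)

lemma mul_left (hK : CoeffLE m 0 K) (h : CoeffLE m F G) : CoeffLE m (K * F) (K * G) := by
  intro s hs
  rw [coeff_mul, coeff_mul]
  refine sum_le_sum fun p hp => ?_
  have hp' := mem_antidiagonal.1 hp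
  have h0 := hK p.1 (by omega)
  rw [map_zero] at h0
  exact mul_le_mul_of_nonneg_left (h p.2 (by omega)) h0

lemma mul_right (hK : CoeffLE m 0 K) (h : CoeffLE m F G) : CoeffLE m (F * K) (G * K) := by
  rw [mul_comm F, mul_comm G]
  exact mul_left hK h

lemma mul_nonneg (hF : CoeffLE m 0 F) (hG : CoeffLE m 0 G) : CoeffLE m 0 (F * G) := by
  simpa using mul_left hF hG

lemma of_sub_nonneg (h : CoeffLE m 0 (G - F)) : CoeffLE m F G := by
  intro s hs
  have := h s hs
  rw [map_zero, map_sub] at this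
  linarith

lemma prod_nonneg {ι : Type*} {t : Finset ι} {f : ι → ℝ⟦X⟧} (h : ∀ i ∈ t, CoeffLE m 0 (f i)) :
    CoeffLE m 0 (∏ i ∈ t, f i) := by
  induction t using Finset.cons_induction with
  | empty =>
    intro s _
    rw [prod_empty, map_zero, coeff_one]
    split_ifs <;> norm_num
  | cons i t hi ih =>
    rw [prod_cons]
    exact (h i (mem_cons_self _ _)).mul_nonneg (ih fun j hj => h j (mem_cons_of_mem hj))

lemma pow_nonneg (h : CoeffLE m 0 F) (n : ℕ) : CoeffLE m 0 (F ^ n) := by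
  rw [← card_range n, ← prod_const]
  exact prod_nonneg fun _ _ => h

lemma C_nonneg {c : ℝ} (hc : 0 ≤ c) : CoeffLE m 0 (C c) := by
  intro s _
  rw [map_zero, coeff_C]
  split_ifs
  exacts [hc, le_rfl]

lemma X_pow_nonneg (n : ℕ) : CoeffLE m 0 ((X : ℝ⟦X⟧) ^ n) := by
  intro s _
  rw [map_zero, coeff_X_pow]
  split_ifs <;> norm_num

lemma one_nonneg : CoeffLE m 0 1 := by simpa using X_pow_nonneg (m := m) 0

lemma geom_nonneg : CoeffLE m 0 geom := by
  intro s _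
  simp [geom]

lemma qnat_nonneg (h : ℕ) : CoeffLE m 0 (qnat h) := by
  intro s _
  rw [map_zero, qnat, map_sum]
  refine sum_nonneg fun i _ => ?_
  rw [coeff_X_pow]
  split_ifs <;> norm_num

lemma qfact_nonneg (n : ℕ) : CoeffLE m 0 (qfact n) := prod_nonneg fun _ _ => qnat_nonneg _

lemma qnat_mono {h k : ℕ} (hk : h ≤ k) : CoeffLE m (qnat h) (qnat k) := by
  intro s _
  rw [qnat, qnat, map_sum, map_sum]
  refine sum_le_sum_of_subset_of_nonneg (range_subset_range.2 hk) fun i _ _ => ?_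
  rw [coeff_X_pow]
  split_ifs <;> norm_num

lemma pathWeight_nonneg (H l h : ℕ) : CoeffLE m 0 (pathWeight H l h) := by
  induction l generalizing h with
  | zero =>
    rcases h with _ | h <;> rw [pathWeight]
    · exact one_nonneg
    · exact CoeffLE.self
  | succ l ih =>
    rcases h with _ | h <;> rw [pathWeight]
    · exact ih _
    · simpa using (ih (h + 2)).add ((qnat_nonneg _).mul_nonneg (ih h))

end CoeffLE

open CoeffLE

/-! ### Upper bounds -/

lemma one_sub_X_mul_geom : (1 - X) * geom = 1 := by
  rw [geom, mul_comm]; exact mk_one_mul_one_sub_eq_one ℝ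

lemma qnat_eq (h : ℕ) : qnat h = (1 - X ^ h) * geom := by
  have h1 : qnat h * (1 - X) = 1 - X ^ h := geom_sum_mul_neg _ _
  calc qnat h = qnat h * ((1 - X) * geom) := by rw [one_sub_X_mul_geom, mul_one]
    _ = _ := by rw [← mul_assoc, h1]

lemma qnat_le_geom (m h : ℕ) : CoeffLE m (qnat h) geom := by
  apply of_sub_nonneg
  rw [qnat_eq, show geom - (1 - X ^ h) * geom = X ^ h * geom by ring]
  exact (X_pow_nonneg h).mul_nonneg geom_nonneg

lemma coeff_geom_pow (n m : ℕ) : coeff m (geom ^ n) = (B n m : ℝ) := by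
  rcases n with _ | n
  · rw [pow_zero, coeff_one, B, if_pos rfl]
    split_ifs <;> simp
  · rw [geom, mk_one_pow_eq_mk_choose_add, coeff_mk, B, if_neg (by omega)]
    congr 2
    omega

lemma qfact_le_geom_pow (m n : ℕ) : CoeffLE m (qfact n) (geom ^ n) := by
  induction n with
  | zero => simp only [qfact, range_zero, prod_empty, pow_zero]; exact CoeffLE.self
  | succ n ih =>
    rw [qfact, prod_range_succ, ← qfact, pow_succ]
    exact (mul_left (qfact_nonneg n) (qnat_le_geom m _)).trans (mul_right geom_nonneg ih)

lemma pathWeight_eq_zero {H l h : ℕ} (hl : l < h) : pathWeight H l h = 0 := by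
  induction l generalizing h with
  | zero =>
    obtain ⟨k, rfl⟩ := Nat.exists_eq_succ_of_ne_zero hl.ne'
    rw [pathWeight]
  | succ l ih =>
    obtain ⟨k, rfl⟩ := Nat.exists_eq_succ_of_ne_zero (Nat.ne_zero_of_lt hl)
    rw [pathWeight, ih (by omega), ih (by omega), mul_zero, add_zero]

/-- Here `d` is the number of remaining down steps. A path that returns to `0` has height at most
`d`, so its next down step weighs at most `qnat d`. -/
lemma pathWeight_le (m l h d : ℕ) (hd : l + h = 2 * d) :
    CoeffLE m (pathWeight 0 l h) (C (paths l h : ℝ) * qfact d) := by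
  induction l generalizing h d with
  | zero =>
    rcases h with _ | h
    · obtain rfl : d = 0 := by omega
      simp only [pathWeight, paths, qfact, range_zero, prod_empty, Nat.cast_one, map_one, mul_one]
      exact CoeffLE.self
    · rw [pathWeight]
      exact (C_nonneg (Nat.cast_nonneg _)).mul_nonneg (qfact_nonneg _)
  | succ l ih =>
    rcases h with _ | h
    · rw [pathWeight, paths]
      exact ih 1 d (by omega)
    · rw [pathWeight, paths, Nat.cast_add, map_add, add_mul]
      refine (ih (h + 2) d (by omega)).add ?_
      rcases lt_or_ge l h with hl | hl
      · rw [pathWeight_eq_zero hl, mul_zero]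
        exact (C_nonneg (Nat.cast_nonneg _)).mul_nonneg (qfact_nonneg _)
      · obtain ⟨d, rfl⟩ : ∃ d', d = d' + 1 := ⟨d - 1, by omega⟩
        refine (mul_left (qnat_nonneg _) (ih h d (by omega))).trans ?_
        rw [qfact, qfact, prod_range_succ, ← qfact, mul_comm (qnat _), ← mul_assoc]
        exact mul_left ((C_nonneg (Nat.cast_nonneg _)).mul_nonneg (qfact_nonneg _))
          (qnat_mono (by omega))

theorem T_le (n m : ℕ) : T n m ≤ catalan n * I n m := by
  have h := pathWeight_le m (2 * n) 0 n rfl m le_rfl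
  rw [← T_eq_coeff, coeff_C_mul, ← I_eq_coeff, paths_two_mul_zero] at h
  exact_mod_cast h

theorem I_le (n m : ℕ) : I n m ≤ B n m := by
  have h := qfact_le_geom_pow m n m le_rfl
  rw [← I_eq_coeff, coeff_geom_pow] at h
  exact_mod_cast h

/-! ### Elevated paths: down steps counted by height -/

/-- Counts the steps down of the paths counted by `paths l h`, with a step down from height `j`
counted as `X ^ j`. -/
noncomputable def downSteps : ℕ → ℕ → ℝ⟦X⟧
  | 0, _ => 0
  | l + 1, 0 => downSteps l 1
  | l + 1, h + 1 => downSteps l (h + 2) + downSteps l h + C (paths l h : ℝ) * X ^ (h + 1)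

lemma downSteps_nonneg (m l h : ℕ) : CoeffLE m 0 (downSteps l h) := by
  induction l generalizing h with
  | zero => rw [downSteps]; exact CoeffLE.self
  | succ l ih =>
    rcases h with _ | h <;> rw [downSteps]
    · exact ih _
    · have := ((ih (h + 2)).add (ih h)).add
        ((C_nonneg (m := m) (c := paths l h) (Nat.cast_nonneg _)).mul_nonneg (X_pow_nonneg (h + 1)))
      simpa using this

lemma coeff_zero_downSteps (l h : ℕ) : coeff 0 (downSteps l h) = 0 := by
  induction l generalizing h with
  | zero => simp [downSteps]
  | succ l ih =>
    rcases h with _ | h <;> rw [downSteps]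
    · exact ih _
    · rw [map_add, map_add, ih, ih, coeff_C_mul, coeff_X_pow]
      simp

/-- Reflecting the part of a path before a marked step down from height `j`. -/
lemma coeff_downSteps (l h j : ℕ) :
    coeff (j + 1) (downSteps l h) =
      ((∑ i ∈ range (min h (j + 1) + 1), paths l (h + 2 * (j + 1) - 2 * i) : ℕ) : ℝ) := by
  induction l generalizing h with
  | zero =>
    rw [downSteps, map_zero, sum_eq_zero, Nat.cast_zero]
    intro i hi
    rw [mem_range] at hi
    exact paths_eq_zero (by omega)
  | succ l ih =>
    have hstep : ∀ k, 0 < k → paths (l + 1) k = paths l (k + 1) + paths l (k - 1) := by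
      rintro (_ | k) hk
      · exact absurd hk (lt_irrefl _)
      · rw [paths]; rfl
    rw [sum_congr rfl fun i hi => hstep _ (by rw [mem_range] at hi; omega), sum_add_distrib]
    rcases h with _ | h
    · rw [downSteps, ih]
      congr 1
      simp only [Nat.zero_min, zero_add, sum_range_one, mul_zero, Nat.sub_zero]
      rw [Nat.min_eq_left (by omega), sum_range_succ, sum_range_one]
      congr 2 <;> omega
    · rw [downSteps, map_add, map_add, ih, ih, coeff_C_mul, coeff_X_pow]
      have e1 : ∀ i ∈ range (min (h + 1) (j + 1) + 1),
          paths l (h + 1 + 2 * (j + 1) - 2 * i + 1) = paths l (h + 2 + 2 * (j + 1) - 2 * i) := by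
        intro i hi
        rw [mem_range] at hi
        congr 1; omega
      have e2 : ∀ i ∈ range (min (h + 1) (j + 1) + 1),
          paths l (h + 1 + 2 * (j + 1) - 2 * i - 1) = paths l (h + 2 * (j + 1) - 2 * i) := by
        intro i hi
        rw [mem_range] at hi
        congr 1; omega
      rw [sum_congr rfl e1, sum_congr rfl e2]
      -- For `h < j` one term moves from the sum for `h + 2` to the sum for `h`. For `h = j` the
      -- missing term is the marked first step. For `h > j` all ranges agree.
      rcases lt_trichotomy h j with hj | hj | hj
      · rw [if_neg (by omega), mul_zero, add_zero, ← Nat.cast_add]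
        congr 1
        rw [Nat.min_eq_left (by omega), Nat.min_eq_left (by omega), Nat.min_eq_left (by omega),
          sum_range_succ _ (h + 2), sum_range_succ _ (h + 1),
          show h + 2 + 2 * (j + 1) - 2 * (h + 2) = h + 2 * (j + 1) - 2 * (h + 1) by omega]
        simp only [sum_range_succ _ (h + 1)]
        ring
      · subst hj
        rw [if_pos rfl, mul_one, ← Nat.cast_add, ← Nat.cast_add]
        congr 1
        rw [Nat.min_eq_right (by omega), Nat.min_eq_left (by omega), Nat.min_eq_left (by omega),
          add_assoc]
        congr 1
        rw [sum_range_succ _ (h + 1)]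
        congr 2
        omega
      · rw [if_neg (by omega), mul_zero, add_zero, ← Nat.cast_add]
        congr 1
        rw [Nat.min_eq_right (by omega), Nat.min_eq_right (by omega), Nat.min_eq_right (by omega)]

lemma coeff_downSteps_le (n j : ℕ) :
    coeff j (downSteps (2 * n) 0) ≤ 3 * j * catalan n := by
  rcases j with _ | j
  · simp [coeff_zero_downSteps]
  · rw [coeff_downSteps]
    have := paths_two_mul_le n (j + 1)
    simp only [Nat.zero_min, zero_add, sum_range_one, mul_zero, Nat.sub_zero]
    have h : (paths (2 * n) (2 * (j + 1)) : ℝ) ≤ (2 * (j + 1) + 1) * catalan n := by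
      exact_mod_cast this
    refine h.trans (mul_le_mul_of_nonneg_right ?_ (Nat.cast_nonneg _))
    push_cast
    linarith [(Nat.cast_nonneg j : (0 : ℝ) ≤ j)]

/-- This is `∏ (1 - x_i) ≥ 1 - ∑ x_i` with `x_i = X ^ (H + j)` for a down step from height `j`,
summed over all paths. -/
lemma le_pathWeight (m H l h d : ℕ) (hd : l + h = 2 * d) :
    CoeffLE m (geom ^ d * (C (paths l h : ℝ) - X ^ H * downSteps l h)) (pathWeight H l h) := by
  induction l generalizing h d with
  | zero =>
    rcases h with _ | h
    · obtain rfl : d = 0 := by omega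
      simp only [pathWeight, paths, downSteps, Nat.cast_one, map_one, mul_zero, sub_zero, mul_one,
        pow_zero]
      exact CoeffLE.self
    · simp only [pathWeight, paths, downSteps, Nat.cast_zero, map_zero, mul_zero, sub_zero]
      exact CoeffLE.self
  | succ l ih =>
    rcases h with _ | h
    · rw [pathWeight, paths, downSteps]
      exact ih 1 d (by omega)
    · obtain ⟨d, rfl⟩ : ∃ d', d = d' + 1 := ⟨d - 1, by omega⟩
      rw [pathWeight, paths, downSteps]
      refine trans (of_sub_nonneg ?_) ((ih (h + 2) (d + 1) (by omega)).add
        (mul_left (qnat_nonneg (H + h + 1)) (ih h d (by omega))))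
      -- The gap in the inequality is the product of `X ^ (H + h + 1)`, from the current step, with
      -- the later error `X ^ H * downSteps l h`.
      have key : CoeffLE m 0 (geom ^ (d + 1) * (X ^ (2 * H + h + 1) * downSteps l h)) :=
        (pow_nonneg geom_nonneg _).mul_nonneg ((X_pow_nonneg _).mul_nonneg (downSteps_nonneg _ _ _))
      convert key using 1
      rw [qnat_eq, Nat.cast_add, map_add]
      ring

/-! ### Restriction to paths with long end runs -/

/-- Raise the path by `H` and append a descent to `0`, whose weights multiply to `qfact H`. -/
lemma qfact_mul_pathWeight_le (m H l h : ℕ) :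
    CoeffLE m (qfact H * pathWeight H l h) (pathWeight 0 (l + H) (h + H)) := by
  induction l generalizing h with
  | zero =>
    rcases h with _ | h
    · rw [pathWeight, mul_one, zero_add]
      induction H with
      | zero => simp only [qfact, range_zero, prod_empty, pathWeight]; exact CoeffLE.self
      | succ H ih =>
        rw [qfact, prod_range_succ, ← qfact, pathWeight, mul_comm, zero_add]
        simpa using (pathWeight_nonneg 0 H (H + 2)).add (mul_left (qnat_nonneg (H + 1)) ih)
    · rw [pathWeight, mul_zero]
      exact pathWeight_nonneg _ _ _
  | succ l ih =>
    rw [show l + 1 + H = l + H + 1 by ring]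
    rcases h with _ | h
    · rw [pathWeight]
      refine (ih 1).trans ?_
      rcases H with _ | H
      · rw [zero_add, add_zero, pathWeight]; exact CoeffLE.self
      · rw [show 0 + (H + 1) = H + 1 by ring, pathWeight, show 1 + (H + 1) = H + 2 by ring]
        simpa using CoeffLE.self.add (F := pathWeight 0 (l + (H + 1)) (H + 2)) ((qnat_nonneg (0 + H + 1)).mul_nonneg
          (pathWeight_nonneg 0 (l + (H + 1)) H))
    · rw [pathWeight, show h + 1 + H = h + H + 1 by ring, pathWeight, mul_add]
      refine CoeffLE.add ?_ ?_
      · have := ih (h + 2)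
        rwa [show h + 2 + H = h + H + 2 by ring] at this
      · have := mul_left (qnat_nonneg (H + h + 1)) (ih h)
        rw [show 0 + (h + H) + 1 = H + h + 1 by ring]
        convert this using 1
        ring

/-- Prepend `k` up steps, each of weight `1`. -/
lemma pathWeight_add_le (m l h k : ℕ) :
    CoeffLE m (pathWeight 0 l (h + k)) (pathWeight 0 (l + k) h) := by
  induction k generalizing h with
  | zero => exact CoeffLE.self
  | succ k ih =>
    have h1 := ih (h + 1)
    rw [show h + 1 + k = h + (k + 1) by ring] at h1
    refine h1.trans ?_
    rw [← add_assoc]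
    rcases h with _ | h
    · rw [pathWeight]; exact CoeffLE.self
    · rw [pathWeight]
      simpa using CoeffLE.self.add (F := pathWeight 0 (l + k) (h + 2)) ((qnat_nonneg (0 + h + 1)).mul_nonneg
        (pathWeight_nonneg 0 (l + k) h))

/-! ### Replacing `X` by a number -/

/-- Consecutive coefficients have ratio `(s + 1) / (k + s + 1)`, which for `s + 1 ≤ m` is at most
`ρ`, because `hm` says `m ≤ ρ * (m + k)`. -/
lemma X_mul_geom_pow_le {m k : ℕ} {ρ : ℝ} (h1 : ρ ≤ 1) (h0 : 0 ≤ ρ) (hm : (1 - ρ) * m ≤ ρ * k) :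
    CoeffLE m (X * geom ^ (k + 1)) (C ρ * geom ^ (k + 1)) := by
  rintro (_ | s) hs
  · rw [coeff_zero_X_mul, coeff_C_mul, coeff_geom_pow]
    positivity
  · rw [coeff_succ_X_mul, coeff_C_mul, coeff_geom_pow, coeff_geom_pow, B, B, if_neg (by omega),
      if_neg (by omega), show k + 1 + s - 1 = k + s by omega,
      show k + 1 + (s + 1) - 1 = k + s + 1 by omega, Nat.add_sub_cancel]
    have h := Nat.choose_mul_succ_eq (k + s) k
    rw [show k + s + 1 - k = s + 1 by omega] at h
    have h' : ((k + s).choose k : ℝ) * (k + s + 1) = (k + s + 1).choose k * (s + 1) := by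
      exact_mod_cast h
    have hpos : (0 : ℝ) < k + s + 1 := by positivity
    refine le_of_mul_le_mul_right ?_ hpos
    rw [h']
    have hs' : (s + 1 : ℝ) ≤ m := by exact_mod_cast hs
    have : (s + 1 : ℝ) ≤ ρ * (k + s + 1) := by nlinarith
    calc ((k + s + 1).choose k : ℝ) * (s + 1) ≤ (k + s + 1).choose k * (ρ * (k + s + 1)) := by gcongr
      _ = _ := by ring

lemma X_pow_mul_geom_pow_le {m k : ℕ} {ρ : ℝ} (h1 : ρ ≤ 1) (h0 : 0 ≤ ρ)
    (hm : (1 - ρ) * m ≤ ρ * k) (h : ℕ) :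
    CoeffLE m (X ^ h * geom ^ (k + 1)) (C (ρ ^ h) * geom ^ (k + 1)) := by
  induction h with
  | zero => simp only [pow_zero, map_one]; exact CoeffLE.self
  | succ h ih =>
    have e1 : (X : ℝ⟦X⟧) ^ (h + 1) * geom ^ (k + 1) = X * (X ^ h * geom ^ (k + 1)) := by ring
    have e2 : X * (C (ρ ^ h) * geom ^ (k + 1)) = C (ρ ^ h) * (X * geom ^ (k + 1)) := by ring
    have e3 : C (ρ ^ (h + 1)) * geom ^ (k + 1) = C (ρ ^ h) * (C ρ * geom ^ (k + 1)) := by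
      rw [pow_succ, map_mul, mul_assoc]
    have hX : CoeffLE m 0 (X : ℝ⟦X⟧) := by simpa using X_pow_nonneg (m := m) 1
    rw [e1, e3]
    refine (mul_left hX ih).trans ?_
    rw [e2]
    exact mul_left (C_nonneg (pow_nonneg h0 h)) (X_mul_geom_pow_le h1 h0 hm)

lemma sum_mul_pow_le {ρ : ℝ} (h0 : 0 ≤ ρ) (h1 : ρ < 1) (s : Finset ℕ) :
    ∑ i ∈ s, (i : ℝ) * ρ ^ i ≤ ρ / (1 - ρ) ^ 2 := by
  have h := hasSum_coe_mul_geometric_of_norm_lt_one (𝕜 := ℝ) (r := ρ)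
    (by rwa [Real.norm_of_nonneg h0])
  exact sum_le_hasSum s (fun i _ => by positivity) h

lemma downSteps_mul_geom_pow_le {m k n : ℕ} {ρ : ℝ} (h0 : 0 ≤ ρ) (h1 : ρ < 1)
    (hm : (1 - ρ) * m ≤ ρ * k) :
    CoeffLE m (downSteps (2 * n) 0 * geom ^ (k + 1))
      (C (3 * (ρ / (1 - ρ) ^ 2) * catalan n) * geom ^ (k + 1)) := by
  intro s hs
  have hg : 0 ≤ coeff s (geom ^ (k + 1)) := by rw [coeff_geom_pow]; positivity
  rw [coeff_mul, coeff_C_mul, Nat.sum_antidiagonal_eq_sum_range_succ_mk]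
  calc ∑ i ∈ range s.succ, coeff i (downSteps (2 * n) 0) * coeff (s - i) (geom ^ (k + 1))
      ≤ ∑ i ∈ range s.succ, (3 * i * catalan n) * (ρ ^ i * coeff s (geom ^ (k + 1))) := by
        refine sum_le_sum fun i hi => ?_
        rw [mem_range, Nat.lt_succ_iff] at hi
        have h2 := X_pow_mul_geom_pow_le h1.le h0 hm i s hs
        rw [coeff_C_mul, coeff_X_pow_mul', if_pos hi] at h2
        have h3 : 0 ≤ coeff (s - i) (geom ^ (k + 1)) := by rw [coeff_geom_pow]; positivity
        exact mul_le_mul (coeff_downSteps_le n i) h2 h3 (by positivity)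
    _ = 3 * (∑ i ∈ range s.succ, (i : ℝ) * ρ ^ i) * catalan n * coeff s (geom ^ (k + 1)) := by
        rw [mul_sum, sum_mul, sum_mul]
        exact sum_congr rfl fun i _ => by ring
    _ ≤ _ := by
        gcongr
        exact sum_mul_pow_le h0 h1 _

/-- Replacing `X` by `ρ` bounds the error by `ρ ^ H * ∑ 3 * j * ρ ^ j` times the main term; `hH`
makes this factor at most `1 / 2`. -/
lemma half_catalan_mul_geom_pow_le {m k H : ℕ} {ρ : ℝ} (h0 : 0 ≤ ρ) (h1 : ρ < 1)
    (hm : (1 - ρ) * m ≤ ρ * k) (hH : 6 * ρ ^ (H + 1) ≤ (1 - ρ) ^ 2) :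
    CoeffLE m (C (catalan (k + 1) / 2 : ℝ) * geom ^ (k + 1))
      (pathWeight H (2 * (k + 1)) 0) := by
  refine trans ?_ (le_pathWeight m H (2 * (k + 1)) 0 (k + 1) rfl)
  have a1 := mul_left (m := m) (downSteps_nonneg m (2 * (k + 1)) 0)
    (X_pow_mul_geom_pow_le h1.le h0 hm H)
  have a2 := mul_left (m := m) (C_nonneg (pow_nonneg h0 H))
    (downSteps_mul_geom_pow_le (n := k + 1) h0 h1 hm)
  intro s hs
  have b1 := a1 s hs
  have b2 := a2 s hs
  have hg : 0 ≤ coeff s (geom ^ (k + 1)) := by rw [coeff_geom_pow]; positivity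
  rw [mul_left_comm _ (C _), coeff_C_mul] at b1
  rw [coeff_C_mul, coeff_C_mul, coeff_C_mul] at b2
  rw [coeff_C_mul, paths_two_mul_zero,
    show geom ^ (k + 1) * (C (catalan (k + 1) : ℝ) - X ^ H * downSteps (2 * (k + 1)) 0) =
      C (catalan (k + 1) : ℝ) * geom ^ (k + 1) -
        downSteps (2 * (k + 1)) 0 * (X ^ H * geom ^ (k + 1)) by ring,
    map_sub, coeff_C_mul]
  have hρ : (0 : ℝ) < (1 - ρ) ^ 2 := pow_pos (by linarith) 2
  have key : ρ ^ H * (3 * (ρ / (1 - ρ) ^ 2)) ≤ 1 / 2 := by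
    rw [show ρ ^ H * (3 * (ρ / (1 - ρ) ^ 2)) = 3 * ρ ^ (H + 1) / (1 - ρ) ^ 2 by ring,
      div_le_iff₀ hρ]
    linarith
  have b3 : ρ ^ H * (3 * (ρ / (1 - ρ) ^ 2) * catalan (k + 1) * coeff s (geom ^ (k + 1))) ≤
      1 / 2 * (catalan (k + 1) * coeff s (geom ^ (k + 1))) := by
    calc _ = ρ ^ H * (3 * (ρ / (1 - ρ) ^ 2)) * (catalan (k + 1) * coeff s (geom ^ (k + 1))) := by
            ring
      _ ≤ _ := by gcongr
  linarith [mul_nonneg (C_nonneg (m := m) (pow_nonneg h0 H)) CoeffLE.self s hs]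

lemma prod_mul_geom_pow_le {m k : ℕ} {ρ : ℝ} (h0 : 0 ≤ ρ) (h1 : ρ < 1)
    (hm : (1 - ρ) * m ≤ ρ * k) (H : ℕ) :
    CoeffLE m (C (∏ i ∈ range H, (1 - ρ ^ (i + 1))) * geom ^ (k + 1 + H))
      (qfact H * geom ^ (k + 1)) := by
  induction H with
  | zero => simp only [qfact, range_zero, prod_empty, map_one, add_zero]; exact CoeffLE.self
  | succ H ih =>
    have hp : 0 ≤ ∏ i ∈ range H, (1 - ρ ^ (i + 1)) :=
      Finset.prod_nonneg fun i _ => sub_nonneg.2 (pow_le_one₀ h0 h1.le)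
    -- The exponent of `geom` has grown, which only relaxes the condition on `ρ`.
    have hm' : (1 - ρ) * m ≤ ρ * (k + H + 1 : ℕ) := by
      push_cast
      nlinarith [mul_nonneg h0 (Nat.cast_nonneg (α := ℝ) H)]
    have a1 := mul_left (qnat_nonneg (m := m) (H + 1)) ih
    have a2 := X_pow_mul_geom_pow_le h1.le h0 hm' (H + 1)
    rw [prod_range_succ, map_mul, show qfact (H + 1) = qfact H * qnat (H + 1) from prod_range_succ _ _]
    refine trans ?_ (show CoeffLE m _ (qfact H * qnat (H + 1) * geom ^ (k + 1)) by
      rw [mul_comm (qfact H), mul_assoc]; exact a1)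
    rw [qnat_eq, show (1 - X ^ (H + 1)) * geom * (C (∏ i ∈ range H, (1 - ρ ^ (i + 1))) *
      geom ^ (k + 1 + H)) = C (∏ i ∈ range H, (1 - ρ ^ (i + 1))) * (geom ^ (k + H + 1 + 1) -
        X ^ (H + 1) * geom ^ (k + H + 1 + 1)) by ring, mul_assoc]
    refine mul_left (C_nonneg hp) fun s hs => ?_
    have := a2 s hs
    rw [coeff_C_mul] at this
    rw [show k + 1 + (H + 1) = k + H + 1 + 1 by ring, coeff_C_mul, map_sub]
    linarith

/-- Lower bound for the number of chord diagrams, from the Dyck paths which start with at least `H`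
steps up and end with at least `H` steps down. -/
lemma le_T {m k H : ℕ} {ρ : ℝ} (h0 : 0 ≤ ρ) (h1 : ρ < 1)
    (hm : (1 - ρ) * m ≤ ρ * k) (hH : 6 * ρ ^ (H + 1) ≤ (1 - ρ) ^ 2) :
    (catalan (k + 1) / 2 : ℝ) * (∏ i ∈ range H, (1 - ρ ^ (i + 1))) * B (k + 1 + H) m ≤
      T (k + 1 + H) m := by
  have a1 := mul_left (qfact_nonneg H) (half_catalan_mul_geom_pow_le h0 h1 hm hH)
  have a2 := mul_left (m := m) (C_nonneg (c := catalan (k + 1) / 2) (by positivity))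
    (prod_mul_geom_pow_le h0 h1 hm H)
  have a3 := qfact_mul_pathWeight_le m H (2 * (k + 1)) 0
  have a4 := pathWeight_add_le m (2 * (k + 1) + H) 0 H
  rw [mul_left_comm] at a1
  have := (((a2.trans a1).trans a3).trans a4) m le_rfl
  rw [show 2 * (k + 1) + H + H = 2 * (k + 1 + H) by ring, ← T_eq_coeff, coeff_C_mul, coeff_C_mul,
    coeff_geom_pow, ← mul_assoc] at this
  exact this

/-! ### Exponential form of the lower bound -/

lemma pow_div_one_sub_pow_le {ρ : ℝ} (h0 : 0 ≤ ρ) (h1 : ρ < 1) (k : ℕ) :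
    ρ ^ (k + 1) / (1 - ρ ^ (k + 1)) ≤ ρ / (1 - ρ) / (k + 1) := by
  have hx : ρ ^ (k + 1) < 1 := pow_lt_one₀ h0 h1 (by omega)
  have hk : (0 : ℝ) < k + 1 := by positivity
  rw [div_div, div_le_div_iff₀ (by linarith) (mul_pos (by linarith) hk)]
  have h2 : (k + 1) * ρ ^ k ≤ ∑ i ∈ range (k + 1), ρ ^ i := by
    calc (k + 1) * ρ ^ k = ∑ i ∈ range (k + 1), ρ ^ k := by simp
      _ ≤ _ := sum_le_sum fun i hi =>
        pow_le_pow_of_le_one h0 h1.le (Nat.lt_succ_iff.1 (mem_range.1 hi))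
  have h3 : (∑ i ∈ range (k + 1), ρ ^ i) * (1 - ρ) = 1 - ρ ^ (k + 1) := geom_sum_mul_neg _ _
  rw [← h3]
  calc ρ ^ (k + 1) * ((1 - ρ) * (k + 1)) = ρ * (((k + 1) * ρ ^ k) * (1 - ρ)) := by ring
    _ ≤ _ := by
      have : 0 ≤ 1 - ρ := by linarith
      gcongr

lemma sum_pow_succ_le {x : ℝ} (h0 : 0 ≤ x) (h1 : x < 1) (H : ℕ) :
    ∑ i ∈ range H, x ^ (i + 1) ≤ x / (1 - x) := by
  have h := (hasSum_geometric_of_lt_one h0 h1).mul_left x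
  rw [div_eq_mul_inv]
  refine le_trans (le_of_eq (sum_congr rfl fun i _ => pow_succ' x i)) ?_
  exact sum_le_hasSum _ (fun i _ => by positivity) h

/-- Expand `-log (1 - ρ ^ i) = ∑ ρ ^ (i * k) / k` and sum over `i` first. The `k`-th term is at most
`ρ / (1 - ρ) / k ^ 2`, and `ζ(2) ≤ 2`. -/
lemma exp_neg_le_prod {ρ : ℝ} (h0 : 0 ≤ ρ) (h1 : ρ < 1) (H : ℕ) :
    Real.exp (-(2 * (ρ / (1 - ρ)))) ≤ ∏ i ∈ range H, (1 - ρ ^ (i + 1)) := by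
  have hlt : ∀ i, ρ ^ (i + 1) < 1 := fun i => pow_lt_one₀ h0 h1 (by omega)
  have hpos : ∀ i ∈ range H, 0 < 1 - ρ ^ (i + 1) := fun i _ => sub_pos.2 (hlt i)
  rw [← Real.le_log_iff_exp_le (prod_pos hpos), Real.log_prod (fun i hi => (hpos i hi).ne'),
    neg_le, ← sum_neg_distrib]
  have hs : HasSum (fun k : ℕ => ∑ i ∈ range H, (ρ ^ (i + 1)) ^ (k + 1) / ((k : ℝ) + 1))
      (∑ i ∈ range H, -Real.log (1 - ρ ^ (i + 1))) :=
    hasSum_sum fun i _ => Real.hasSum_pow_div_log_of_abs_lt_one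
      (by rw [abs_of_nonneg (pow_nonneg h0 _)]; exact hlt i)
  have hz : HasSum (fun k : ℕ => 1 / ((k + 1 : ℕ) : ℝ) ^ 2) (Real.pi ^ 2 / 6) := by
    have := (hasSum_nat_add_iff' 1).2 hasSum_zeta_two
    simpa using this
  have hb := hz.mul_left (ρ / (1 - ρ))
  have hρ : 0 ≤ ρ / (1 - ρ) := div_nonneg h0 (by linarith)
  refine (hasSum_le (fun k => ?_) hs hb).trans ?_
  · rw [← sum_div]
    have e : ∀ i ∈ range H, (ρ ^ (i + 1)) ^ (k + 1) = (ρ ^ (k + 1)) ^ (i + 1) := by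
      intro i _
      rw [← pow_mul, ← pow_mul, mul_comm]
    rw [sum_congr rfl e]
    have := (sum_pow_succ_le (pow_nonneg h0 _) (hlt k) H).trans (pow_div_one_sub_pow_le h0 h1 k)
    have hk : (0 : ℝ) < k + 1 := by positivity
    calc _ ≤ ρ / (1 - ρ) / (k + 1) / (k + 1) := by gcongr
      _ = _ := by push_cast; field_simp
  · have hpi : Real.pi ^ 2 / 6 ≤ 2 := by nlinarith [Real.pi_lt_d2, Real.pi_pos]
    nlinarith

/-- The lower bound of `le_T` in exponential form. -/
lemma exp_mul_le_T {n m H : ℕ} {x : ℝ} (hn : H + 1 ≤ n) (hx : 0 ≤ x)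
    (hm : (m : ℝ) ≤ x * (n - H - 1)) (hH : 6 * (x / (1 + x)) ^ (H + 1) * (1 + x) ^ 2 ≤ 1) :
    Real.exp (-(H * Real.log 4 + 2 * x)) * catalan n * B n m ≤ 2 * T n m := by
  obtain ⟨k, rfl⟩ : ∃ k, n = k + 1 + H := ⟨n - H - 1, by omega⟩
  have hx1 : 0 < 1 + x := by linarith
  -- For `ρ = x / (1 + x)` one has `ρ / (1 - ρ) = x`, and the condition on `ρ` becomes `m ≤ x * k`.
  have e1 : 1 - x / (1 + x) = 1 / (1 + x) := by field_simp; ring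
  have h0 : 0 ≤ x / (1 + x) := by positivity
  have h1 : x / (1 + x) < 1 := by rw [div_lt_one hx1]; linarith
  have e2 : x / (1 + x) / (1 - x / (1 + x)) = x := by rw [e1]; field_simp
  have hk : (m : ℝ) ≤ x * k := by
    push_cast at hm
    linarith
  have a1 := le_T (m := m) (k := k) (H := H) h0 h1
    (by rw [e1, div_mul_eq_mul_div, div_mul_eq_mul_div, one_mul]; gcongr)
    (by rw [e1, div_pow 1, one_pow, le_div_iff₀ (by positivity)]; exact hH)
  have a2 := exp_neg_le_prod h0 h1 H
  rw [e2] at a2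
  have a3 : (catalan (k + 1 + H) : ℝ) ≤ 4 ^ H * catalan (k + 1) := by
    exact_mod_cast catalan_add_le (k + 1) H
  have e4 : Real.exp (H * Real.log 4) = 4 ^ H := by
    rw [Real.exp_nat_mul, Real.exp_log (by norm_num)]
  have e5 : Real.exp (-(H * Real.log 4 + 2 * x)) = (4 ^ H)⁻¹ * Real.exp (-(2 * x)) := by
    rw [neg_add, Real.exp_add, Real.exp_neg (H * Real.log 4), e4]
  rw [e5]
  calc (4 ^ H)⁻¹ * Real.exp (-(2 * x)) * catalan (k + 1 + H) * B (k + 1 + H) m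
      ≤ (4 ^ H)⁻¹ * (∏ i ∈ range H, (1 - (x / (1 + x)) ^ (i + 1))) * (4 ^ H * catalan (k + 1)) *
          B (k + 1 + H) m := by
        have : 0 ≤ ∏ i ∈ range H, (1 - (x / (1 + x)) ^ (i + 1)) := (Real.exp_pos _).le.trans a2
        gcongr
    _ = 2 * ((catalan (k + 1) / 2 : ℝ) * (∏ i ∈ range H, (1 - (x / (1 + x)) ^ (i + 1))) *
          B (k + 1 + H) m) := by
        field_simp
    _ ≤ _ := by linarith

end ChordDiagrams

namespace ChordDiagrams

/-! ### Choice of `x` and `H` -/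

/-- `x / (1 + x) ≤ exp (-1 / (1 + x))`, so its `H`-th power is at most `exp (-2) / (1 + x) ^ 2`, and
`6 ≤ exp 2`. -/
lemma six_mul_pow_mul_sq_le {x : ℝ} (hx : 0 ≤ x) {H : ℕ}
    (hH : (1 + x) * (2 * Real.log (1 + x) + 2) ≤ H) :
    6 * (x / (1 + x)) ^ (H + 1) * (1 + x) ^ 2 ≤ 1 := by
  have hx1 : 0 < 1 + x := by linarith
  have h0 : 0 ≤ x / (1 + x) := by positivity
  have h1 : x / (1 + x) ≤ 1 := by rw [div_le_one hx1]; linarith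
  have h2 : x / (1 + x) ≤ Real.exp (-(1 / (1 + x))) := by
    have := Real.add_one_le_exp (-(1 / (1 + x)))
    have e : -(1 / (1 + x)) + 1 = x / (1 + x) := by field_simp; ring
    linarith
  have h3 : (x / (1 + x)) ^ (H + 1) ≤ Real.exp (-(2 * Real.log (1 + x) + 2)) := by
    calc (x / (1 + x)) ^ (H + 1) ≤ (x / (1 + x)) ^ H := pow_le_pow_of_le_one h0 h1 (by omega)
      _ ≤ Real.exp (-(1 / (1 + x))) ^ H := by gcongr
      _ = Real.exp (-(H / (1 + x))) := by rw [← Real.exp_nat_mul]; congr 1; ring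
      _ ≤ _ := by
        rw [Real.exp_le_exp, neg_le_neg_iff, le_div_iff₀ hx1]
        linarith
  have h4 : Real.exp (-(2 * Real.log (1 + x) + 2)) * (1 + x) ^ 2 = Real.exp (-2) := by
    have : (1 + x) ^ 2 = Real.exp (2 * Real.log (1 + x)) := by
      rw [two_mul, Real.exp_add, Real.exp_log hx1, sq]
    rw [this, ← Real.exp_add]
    congr 1; ring
  have h5 : 6 * Real.exp (-2) ≤ 1 := by
    rw [Real.exp_neg, ← div_eq_mul_inv, div_le_one (Real.exp_pos _)]
    have h6 : Real.exp 2 = Real.exp 1 * Real.exp 1 := by rw [← Real.exp_add]; norm_num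
    rw [h6]
    nlinarith [Real.exp_one_gt_d9]
  calc 6 * (x / (1 + x)) ^ (H + 1) * (1 + x) ^ 2
      ≤ 6 * Real.exp (-(2 * Real.log (1 + x) + 2)) * (1 + x) ^ 2 := by gcongr
    _ ≤ 1 := by rw [mul_assoc, h4]; exact h5

lemma le_T_of_exponent_le {n m H : ℕ} {A x : ℝ} (hn : H + 1 ≤ n) (hx : 0 ≤ x)
    (hm : (m : ℝ) ≤ x * (n - H - 1)) (hH : 6 * (x / (1 + x)) ^ (H + 1) * (1 + x) ^ 2 ≤ 1)
    (hA : H * Real.log 4 + 2 * x ≤ 2 * ((m : ℝ) / n) * Real.log n + A) :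
    Real.exp (-2 * ((m : ℝ) / n) * Real.log n) * catalan n * B n m ≤ 2 * Real.exp A * T n m := by
  have h := exp_mul_le_T hn hx hm hH
  have h2 : Real.exp (-2 * ((m : ℝ) / n) * Real.log n) ≤
      Real.exp A * Real.exp (-(H * Real.log 4 + 2 * x)) := by
    rw [← Real.exp_add, Real.exp_le_exp]
    linarith
  calc _ ≤ Real.exp A * Real.exp (-(H * Real.log 4 + 2 * x)) * catalan n * B n m := by gcongr
    _ = Real.exp A * (Real.exp (-(H * Real.log 4 + 2 * x)) * catalan n * B n m) := by ring
    _ ≤ Real.exp A * (2 * T n m) := by gcongr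
    _ = _ := by ring

lemma le_T_of_le {n m : ℕ} (hlog : 40 ≤ Real.log n)
    (hn : √(n : ℝ) * (Real.log n + 2) + 2 ≤ n / 6) (hm : (m : ℝ) ≤ n * √(n : ℝ) / 10) :
    Real.exp (-2 * ((m : ℝ) / n) * Real.log n) * catalan n * B n m ≤
      2 * Real.exp 1400 * T n m := by
  have hsq : 0 ≤ √(n : ℝ) := Real.sqrt_nonneg _
  have hn12 : (12 : ℝ) ≤ n := by nlinarith
  have hn0 : (0 : ℝ) < n := by linarith
  obtain ⟨μ, hμ⟩ : ∃ μ : ℝ, μ = m / n := ⟨_, rfl⟩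
  have hmμ : (m : ℝ) = μ * n := by rw [hμ]; field_simp
  have hμ0 : 0 ≤ μ := by rw [hμ]; positivity
  have hx : 0 ≤ 6 / 5 * μ := by positivity
  -- The factor `6 / 5` compensates for `n - H - 1 ≥ 5 * n / 6`.
  have hmx : ∀ H : ℕ, (H + 1 : ℝ) ≤ n / 6 → (m : ℝ) ≤ 6 / 5 * μ * (n - H - 1) := by
    intro H hH
    rw [hmμ]
    nlinarith
  -- For small `μ` no end runs are needed: `H = 0` already satisfies the smallness condition.
  rcases le_or_gt μ (1 / 10) with h | h
  · refine le_T_of_exponent_le (H := 0) (x := 6 / 5 * μ) ?_ hx (hmx 0 ?_) ?_ ?_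
    · have : (1 : ℝ) ≤ n := by linarith
      exact_mod_cast this
    · push_cast; linarith
    · have e : 6 * (6 / 5 * μ / (1 + 6 / 5 * μ)) ^ (0 + 1) * (1 + 6 / 5 * μ) ^ 2 =
          6 * (6 / 5 * μ) * (1 + 6 / 5 * μ) := by
        rw [zero_add, pow_one]
        field_simp
      rw [e]
      nlinarith
    · rw [← hμ]
      push_cast
      nlinarith
  · have hL : 0 < 1 + 6 / 5 * μ := by linarith
    have hμs : μ ≤ √(n : ℝ) / 10 := by
      rw [hμ, div_le_iff₀ hn0]; linarith
    have hs2 : 2 ≤ √(n : ℝ) := Real.le_sqrt_of_sq_le (by linarith)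
    have hΛ : 1 + 6 / 5 * μ ≤ √(n : ℝ) := by linarith
    have hlogΛ : 2 * Real.log (1 + 6 / 5 * μ) ≤ Real.log n := by
      have := Real.log_le_log hL hΛ
      rw [Real.log_sqrt hn0.le] at this
      linarith
    have hlog0 : 0 ≤ Real.log (1 + 6 / 5 * μ) := Real.log_nonneg (by linarith)
    set Λ := 1 + 6 / 5 * μ with hΛdef
    set H := ⌈Λ * (2 * Real.log Λ + 2)⌉₊
    have hH1 : Λ * (2 * Real.log Λ + 2) ≤ H := Nat.le_ceil _
    have hH2 : (H : ℝ) ≤ Λ * (2 * Real.log Λ + 2) + 1 := (Nat.ceil_lt_add_one (by positivity)).le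
    have hH3 : (H + 1 : ℝ) ≤ n / 6 := by
      have : Λ * (2 * Real.log Λ + 2) ≤ √(n : ℝ) * (Real.log n + 2) := by gcongr
      linarith
    have hlog4 : Real.log 4 ≤ 1.387 := by
      rw [show (4 : ℝ) = 2 ^ 2 by norm_num, Real.log_pow]
      have := Real.log_two_lt_d9
      push_cast
      linarith
    have hHlog : H * Real.log 4 ≤ H * 1.387 := by gcongr
    refine le_T_of_exponent_le (H := H) (x := 6 / 5 * μ) ?_ hx (hmx H hH3)
      (six_mul_pow_mul_sq_le hx hH1) ?_
    · have : (H + 1 : ℝ) ≤ n := by linarith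
      exact_mod_cast this
    · rw [← hμ]
      -- Bounded `Λ` gives a bounded exponent, absorbed by `1400`. Otherwise `Λ ≤ 1.26 * μ`, and
      -- since `1.26 * 1.387 < 2`, the remaining multiple of `μ * log n` absorbs the terms linear in
      -- `μ`.
      rcases le_or_gt Λ 21 with h21 | h21
      · have h3 : Real.log Λ ≤ 20 := by linarith [Real.log_le_sub_one_of_pos hL]
        have h4 : Λ * (2 * Real.log Λ + 2) ≤ 21 * (2 * 20 + 2) := by gcongr
        have h5 : 0 ≤ 2 * μ * Real.log n := by positivity
        linarith
      · have h3 : Λ * (2 * Real.log Λ + 2) ≤ (1.26 * μ) * (Real.log n + 2) := by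
          gcongr
          linarith
        have h4 : μ * 40 ≤ μ * Real.log n := by gcongr
        nlinarith

lemma eventually_sqrt_mul_log_le :
    ∀ᶠ n : ℕ in atTop, √(n : ℝ) * (Real.log n + 2) + 2 ≤ n / 6 := by
  have h1 : ∀ᶠ y : ℝ in atTop, Real.log y ≤ (1 / 72) * y ^ (1 / 2 : ℝ) := by
    filter_upwards [(isLittleO_log_rpow_atTop (r := 1 / 2) (by norm_num)).bound
      (show (0 : ℝ) < 1 / 72 by norm_num), eventually_ge_atTop 1] with y hy hy1
    rw [Real.norm_of_nonneg (Real.log_nonneg hy1), Real.norm_of_nonneg (by positivity)] at hy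
    exact hy
  filter_upwards [tendsto_natCast_atTop_atTop.eventually h1,
    (tendsto_natCast_atTop_atTop (R := ℝ)).eventually_ge_atTop 40000] with n hn hn2
  rw [← Real.sqrt_eq_rpow] at hn
  have hs : 200 ≤ √(n : ℝ) := Real.le_sqrt_of_sq_le (by linarith)
  have hss : √(n : ℝ) * √(n : ℝ) = n := Real.mul_self_sqrt (Nat.cast_nonneg n)
  nlinarith

theorem exp_mul_isBigO_T (n m : ℕ → ℕ) (hn : Tendsto n atTop atTop)
    (hm : (fun k => (m k : ℝ)) =o[atTop] (fun k => (n k : ℝ) ^ (3 / 2 : ℝ))) :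
    (fun k => Real.exp (-2 * ((m k : ℝ) / (n k : ℝ)) * Real.log (n k : ℝ)) *
        (catalan (n k) : ℝ) * (B (n k) (m k) : ℝ))
      =O[atTop] (fun k => (T (n k) (m k) : ℝ)) := by
  refine IsBigO.of_bound (2 * Real.exp 1400) ?_
  have hlog : ∀ᶠ n : ℕ in atTop, 40 ≤ Real.log n :=
    (Real.tendsto_log_atTop.comp tendsto_natCast_atTop_atTop).eventually_ge_atTop 40
  filter_upwards [hn.eventually hlog, hn.eventually eventually_sqrt_mul_log_le,
    hn.eventually_gt_atTop 0, hm.bound (show (0 : ℝ) < 1 / 10 by norm_num)] with k h1 h2 h3 h4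
  have hpos : (0 : ℝ) < n k := by exact_mod_cast h3
  have hpow : (n k : ℝ) ^ (3 / 2 : ℝ) = n k * √(n k : ℝ) := by
    rw [Real.sqrt_eq_rpow, ← Real.rpow_one_add' hpos.le (by norm_num)]
    norm_num
  rw [Real.norm_of_nonneg (by positivity), Real.norm_of_nonneg (by positivity), hpow] at h4
  rw [Real.norm_of_nonneg (by positivity), Real.norm_of_nonneg (by positivity)]
  exact le_T_of_le h1 h2 (by linarith)

end ChordDiagrams

theorem mainTheorem8 :
    (∀ n m : ℕ,
      ChordDiagrams.T n m ≤ catalan n * ChordDiagrams.I n m ∧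
      catalan n * ChordDiagrams.I n m ≤ catalan n * ChordDiagrams.B n m) ∧
    (∀ n m : ℕ → ℕ,
      Tendsto n atTop atTop →
      (fun k => (m k : ℝ)) =o[atTop] (fun k => (n k : ℝ) ^ (3 / 2 : ℝ)) →
      (fun k => Real.exp (-2 * ((m k : ℝ) / (n k : ℝ)) * Real.log (n k : ℝ)) *
          (catalan (n k) : ℝ) * (ChordDiagrams.B (n k) (m k) : ℝ))
        =O[atTop] (fun k => (ChordDiagrams.T (n k) (m k) : ℝ))) :=
  ⟨fun n m => ⟨ChordDiagrams.T_le n m, Nat.mul_le_mul_left _ (ChordDiagrams.I_le n m)⟩,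
    ChordDiagrams.exp_mul_isBigO_T⟩
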